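/- Let $\mu$ be a probability measure on $\mathbb{R}$ with density $\frac{d\mu}{dx}(x) = e^{-v(x)}$, where $v:\mathbb{R}\to\mathbb{R}$ is twice continuously differentiable and, for a given $\varepsilon>0$, $v''(x)\ge \varepsilon$ for all $x\in\mathbb{R}$. Suppose that $\mu$ has mean zero, $\int x\,d\mu(x)=0$, and let $\gamma$ be the standard Gaussian measure on $\mathbb{R}$. Then, with the absolute constant $c = 1-\log 2 > 0$, $$ \Big(\tfrac12 + c\,\min\{1,\sqrt{\varepsilon}\}\Big)\, W_2^2(\mu,\gamma) \;\le\; D(\mu|\gamma), $$ where $W_2(\mu,\gamma) = \inf_\pi \big(\iint |x-z|^2\,d\pi(x,z)\big)^{1/2}$, the infimum running over all probability measures $\pi$ on $\mathbb{R}\times\mathbb{R}$ with marginals $\mu$ and $\gamma$, and $D(\mu|\gamma) = \int \log\frac{d\mu}{d\gamma}\,d\mu$ is the relative entropy. -/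

import Mathlib

open MeasureTheory ProbabilityTheory InformationTheory

open scoped ENNReal

/-- `π` has first marginal `μ` and second marginal `ν`. When `μ` is a probability measure,
`π` is then automatically one as well. -/
def IsCoupling {E : Type*} [MeasurableSpace E] (π : Measure (E × E)) (μ ν : Measure E) : Prop :=
  π.map Prod.fst = μ ∧ π.map Prod.snd = ν

/-- The quadratic Kantorovich distance
`W₂(μ, ν) = inf_π (∫∫ |x - z|² dπ(x, z))^{1/2}`, the infimum running over all couplings `π`
of `μ` and `ν`, with values in `[0, ∞]`. -/
noncomputable def W2 {E : Type*} [MeasurableSpace E] [PseudoEMetricSpace E]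
    (μ ν : Measure E) : ℝ≥0∞ :=
  ⨅ (π : Measure (E × E)) (_ : IsCoupling π μ ν),
    (∫⁻ p, edist p.1 p.2 ^ 2 ∂π) ^ (1 / 2 : ℝ)

/-! Let `T` be the increasing map pushing the standard Gaussian `γ` forward to `μ`, and let
`k = T - id`. The relative entropy is `∫ ((T² - x²) / 2 - log T') ∂γ`, whose integrand is
`k² / 2 + (x k - k') + (k' - log (1 + k'))`. The middle term integrates to zero by Stein's identity.
Caffarelli's bound `T' ≤ 1 / √ε` keeps `k'` in a range where
`k' - log (1 + k') ≥ (1 - log 2) min(1, √ε) k'²`, and the Gaussian Poincaré inequality bounds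
`∫ k'² ∂γ` below by the variance of `k`. Since the mean of `k` is that of `μ`, this variance is
`∫ k² ∂γ`, the transport cost of `T`, when `μ` is centred. -/

open Filter Real Set Topology
open scoped NNReal

section Logarithm

variable {r u : ℝ}

lemma one_sub_log_two_pos : 0 < 1 - log 2 := by linarith [log_two_lt_d9]

lemma one_add_mul_pos {t : ℝ} (hu : -1 < u) (ht : t ∈ Icc (0 : ℝ) 1) : 0 < 1 + t * u := by
  rcases ht.1.eq_or_lt with rfl | ht0
  · simp
  · nlinarith [ht.2]

lemma intervalIntegrable_mul_sq_div_one_add_mul (hu : -1 < u) :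
    IntervalIntegrable (fun t ↦ t * u ^ 2 / (1 + t * u)) volume 0 1 := by
  refine ContinuousOn.intervalIntegrable fun t ht ↦ ContinuousAt.continuousWithinAt ?_
  rw [uIcc_of_le zero_le_one] at ht
  have hpos := one_add_mul_pos hu ht
  fun_prop (disch := exact hpos.ne')

lemma sub_log_one_add_eq_integral (hu : -1 < u) :
    u - log (1 + u) = ∫ t in (0 : ℝ)..1, t * u ^ 2 / (1 + t * u) := by
  have hderiv (t : ℝ) (ht : t ∈ uIcc (0 : ℝ) 1) :
      HasDerivAt (fun t ↦ t * u - log (1 + t * u)) (t * u ^ 2 / (1 + t * u)) t := by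
    rw [uIcc_of_le zero_le_one] at ht
    have hne := (one_add_mul_pos hu ht).ne'
    have hlin : HasDerivAt (fun t ↦ t * u) u t := by simpa using (hasDerivAt_id t).mul_const u
    have hlog : HasDerivAt (fun t ↦ log (1 + t * u)) (u / (1 + t * u)) t :=
      (hlin.const_add 1).log hne
    refine (hlin.sub hlog).congr_deriv ?_
    rw [eq_div_iff hne, sub_mul, div_mul_cancel₀ _ hne]
    ring
  rw [intervalIntegral.integral_eq_sub_of_hasDerivAt hderiv
    (intervalIntegrable_mul_sq_div_one_add_mul hu)]
  simp

lemma one_sub_log_two_mul_sq_le (hr1 : r ≤ 1) (hu : -1 < u) (hru : r * u ≤ 1) :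
    (1 - log 2) * r * u ^ 2 ≤ u - log (1 + u) := by
  -- The constant is the value at `u = 1` of the integral for `u - log (1 + u)`, so it suffices
  -- to compare the integrands, which amounts to `r * (1 + t * u) ≤ 1 + t`.
  have hone : 1 - log 2 = ∫ t in (0 : ℝ)..1, t * 1 ^ 2 / (1 + t * 1) := by
    rw [← sub_log_one_add_eq_integral (by norm_num), one_add_one_eq_two]
  rw [sub_log_one_add_eq_integral hu, hone, mul_assoc, ← intervalIntegral.integral_mul_const]
  refine intervalIntegral.integral_mono_on zero_le_one
    ((intervalIntegrable_mul_sq_div_one_add_mul (by norm_num)).mul_const _)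
    (intervalIntegrable_mul_sq_div_one_add_mul hu) fun t ht ↦ ?_
  have hcompare : r * (1 + t * u) ≤ 1 + t := by nlinarith [ht.1]
  rw [div_mul_eq_mul_div, div_le_div_iff₀ (by linarith [ht.1]) (one_add_mul_pos hu ht)]
  calc t * 1 ^ 2 * (r * u ^ 2) * (1 + t * u) = t * u ^ 2 * (r * (1 + t * u)) := by ring
    _ ≤ t * u ^ 2 * (1 + t) := mul_le_mul_of_nonneg_left hcompare (mul_nonneg ht.1 (sq_nonneg u))
    _ = t * u ^ 2 * (1 + t * 1) := by ring

end Logarithm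

section Contraction

lemma deriv_deriv_nonneg_of_isLocalMin {f : ℝ → ℝ} {a : ℝ} (h : IsLocalMin f a)
    (hf : ContinuousAt f a) : 0 ≤ deriv (deriv f) a := by
  by_contra! hneg
  have hmax : IsLocalMax f a := isLocalMax_of_deriv_deriv_neg hneg h.deriv_eq_zero hf
  have hconst : f =ᶠ[𝓝 a] fun _ ↦ f a := by
    filter_upwards [h, hmax] with x hmin hmax using le_antisymm hmax hmin
  have hzero : deriv (deriv f) a = 0 := by
    simpa [Pi.zero_def] using hconst.deriv.deriv_eq
  exact hneg.ne hzero

variable {u v T : ℝ → ℝ} {K ε a b : ℝ}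

lemma hasDerivAt_exp_neg_comp_sub_exp_neg (hu : Differentiable ℝ u) (hv : Differentiable ℝ v)
    (hT : ∀ x, HasDerivAt T (exp (v (T x) - u x)) x) (x : ℝ) :
    HasDerivAt (fun x ↦ a * exp (-v (T x)) - b * exp (-u x))
      (exp (-u x) * (b * deriv u x - a * deriv v (T x))) x := by
  have hvT : HasDerivAt (fun x ↦ v (T x)) (deriv v (T x) * exp (v (T x) - u x)) x :=
    (hv (T x)).hasDerivAt.comp x (hT x)
  have hexp : exp (-v (T x)) * exp (v (T x) - u x) = exp (-u x) := by
    rw [← exp_add]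
    ring_nf
  refine ((hvT.fun_neg.exp.const_mul a).sub
    ((hu x).hasDerivAt.fun_neg.exp.const_mul b)).congr_deriv ?_
  linear_combination a * deriv v (T x) * -hexp

lemma hasDerivAt_exp_neg_mul_sub_of_eq_zero (hu : Differentiable ℝ u)
    (hu' : Differentiable ℝ (deriv u)) (hv' : Differentiable ℝ (deriv v))
    (hT : ∀ x, HasDerivAt T (exp (v (T x) - u x)) x) {z : ℝ}
    (hz : b * deriv u z - a * deriv v (T z) = 0) :
    HasDerivAt (fun x ↦ exp (-u x) * (b * deriv u x - a * deriv v (T x)))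
      (exp (-u z) * (b * deriv (deriv u) z
        - a * (deriv (deriv v) (T z) * exp (v (T z) - u z)))) z := by
  have hvT : HasDerivAt (fun x ↦ deriv v (T x)) (deriv (deriv v) (T z) * exp (v (T z) - u z)) z :=
    (hv' (T z)).hasDerivAt.comp z (hT z)
  refine ((hu z).hasDerivAt.fun_neg.exp.mul
    (((hu' z).hasDerivAt.const_mul b).sub (hvT.const_mul a))).congr_deriv ?_
  simp only [Pi.sub_apply, hz, mul_zero, zero_add]

/-- Caffarelli's contraction theorem on the line, as a maximum principle: were the bound violated,
`√K * exp (-v ∘ T) - √ε * exp (-u)` would attain a negative minimum, where its second derivative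
is negative. -/
lemma sqrt_mul_exp_sub_le_sqrt (hu : Differentiable ℝ u) (hu' : Differentiable ℝ (deriv u))
    (huK : ∀ x, deriv (deriv u) x ≤ K) (hK : 0 < K) (hu_top : Tendsto u (cocompact ℝ) atTop)
    (hv : Differentiable ℝ v) (hvε : ∀ x, ε ≤ deriv (deriv v) x) (hε : 0 < ε)
    (hT : ∀ x, HasDerivAt T (exp (v (T x) - u x)) x) (x : ℝ) :
    √ε * exp (v (T x) - u x) ≤ √K := by
  have hv' : Differentiable ℝ (deriv v) := fun y ↦
    differentiableAt_of_deriv_ne_zero (hε.trans_le (hvε y)).ne'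
  let g : ℝ → ℝ := fun y ↦ √K * exp (-v (T y)) - √ε * exp (-u y)
  have hg (y : ℝ) : HasDerivAt g (exp (-u y) * (√ε * deriv u y - √K * deriv v (T y))) y :=
    hasDerivAt_exp_neg_comp_sub_exp_neg hu hv hT y
  have hg_neg (y : ℝ) : g y < 0 ↔ √K < √ε * exp (v (T y) - u y) := by
    have hexp : exp (-u y) = exp (v (T y) - u y) * exp (-v (T y)) := by
      rw [← exp_add]
      ring_nf
    rw [sub_neg, hexp, ← mul_assoc, mul_lt_mul_iff_left₀ (exp_pos _)]
  by_contra! hx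
  rw [← hg_neg] at hx
  obtain ⟨z, hz⟩ : ∃ z, ∀ y, g z ≤ g y := by
    have hlim : Tendsto (fun y ↦ -(√ε * exp (-u y))) (cocompact ℝ) (𝓝 0) := by
      simpa using ((tendsto_exp_neg_atTop_nhds_zero.comp hu_top).const_mul √ε).neg
    refine Continuous.exists_forall_le'
      (continuous_iff_continuousAt.2 fun y ↦ (hg y).continuousAt) x ?_
    filter_upwards [hlim.eventually_const_lt hx] with y hy
    exact hy.le.trans (by
      simpa [g] using mul_nonneg (sqrt_nonneg K) (exp_pos (-v (T y))).le)
  have hz_min : IsLocalMin g z := Eventually.of_forall hz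
  have hz_crit : √ε * deriv u z - √K * deriv v (T z) = 0 :=
    (mul_eq_zero.1 (hz_min.hasDerivAt_eq_zero (hg z))).resolve_left (exp_ne_zero _)
  have hz_second := deriv_deriv_nonneg_of_isLocalMin hz_min (hg z).continuousAt
  rw [funext fun y ↦ (hg y).deriv,
    (hasDerivAt_exp_neg_mul_sub_of_eq_zero hu hu' hv' hT hz_crit).deriv] at hz_second
  refine hz_second.not_gt (mul_neg_of_pos_of_neg (exp_pos _) (sub_neg.2 ?_))
  calc √ε * deriv (deriv u) z ≤ √ε * K := by gcongr; exact huK z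
    _ = √K * √ε * √K := by rw [mul_right_comm, mul_self_sqrt hK.le, mul_comm]
    _ < √K * √ε * (√ε * exp (v (T z) - u z)) := by
      gcongr
      exact (hg_neg z).1 ((hz x).trans_lt hx)
    _ = √K * (ε * exp (v (T z) - u z)) := by
      rw [mul_assoc, ← mul_assoc √ε, mul_self_sqrt hε.le]
    _ ≤ √K * (deriv (deriv v) (T z) * exp (v (T z) - u z)) := by gcongr; exact hvε _

end Contraction

/-- The measure `μ` on the line has the continuous, everywhere positive density `exp (-u)`; in the
language of statistical mechanics, `u` is its potential. -/
structure HasPotential (μ : Measure ℝ) (u : ℝ → ℝ) : Prop where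
  continuous : Continuous u
  eq_withDensity : μ = volume.withDensity fun x ↦ ENNReal.ofReal (exp (-u x))

/-- Minus the logarithm of the density of `gaussianReal m s`, for `s ≠ 0`. -/
noncomputable def gaussianPotential (m : ℝ) (s : ℝ≥0) (x : ℝ) : ℝ :=
  (x - m) ^ 2 / (2 * s) + log √(2 * π * s)

section Potential

variable {μ ν : Measure ℝ} {u v g : ℝ → ℝ}

namespace HasPotential

lemma measurable_density (hμ : HasPotential μ u) :
    Measurable fun x ↦ ENNReal.ofReal (exp (-u x)) := by
  have := hμ.continuous.measurable
  fun_prop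

lemma integrable_iff (hμ : HasPotential μ u) :
    Integrable g μ ↔ Integrable fun x ↦ exp (-u x) * g x := by
  rw [hμ.eq_withDensity,
    integrable_withDensity_iff_integrable_smul' hμ.measurable_density (by simp)]
  simp only [ENNReal.toReal_ofReal (exp_pos _).le, smul_eq_mul]

lemma integral_eq (hμ : HasPotential μ u) : ∫ x, g x ∂μ = ∫ x, exp (-u x) * g x := by
  rw [hμ.eq_withDensity,
    integral_withDensity_eq_integral_toReal_smul hμ.measurable_density (by simp)]
  simp only [ENNReal.toReal_ofReal (exp_pos _).le, smul_eq_mul]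

lemma integral_deriv_sub_deriv_mul_eq_zero (hμ : HasPotential μ u) (hu : Differentiable ℝ u)
    {g' : ℝ → ℝ} (hg : ∀ x, HasDerivAt g (g' x) x) (hg_int : Integrable g μ)
    (hg'_int : Integrable (fun x ↦ g' x - deriv u x * g x) μ) :
    ∫ x, (g' x - deriv u x * g x) ∂μ = 0 := by
  rw [hμ.integrable_iff] at hg_int hg'_int
  rw [hμ.integral_eq]
  refine integral_eq_zero_of_hasDerivAt_of_integrable (fun x ↦ ?_) hg'_int hg_int
  refine ((hu x).hasDerivAt.fun_neg.exp.mul (hg x)).congr_deriv ?_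
  ring

lemma absolutelyContinuous (hμ : HasPotential μ u) : μ ≪ volume := by
  rw [hμ.eq_withDensity]
  exact withDensity_absolutelyContinuous _ _

lemma llr_ae_eq (hμ : HasPotential μ u) (hν : HasPotential ν v) :
    llr μ ν =ᵐ[μ] fun x ↦ v x - u x := by
  have : SigmaFinite μ := by
    rw [hμ.eq_withDensity]
    exact SigmaFinite.withDensity_of_ne_top (ae_of_all _ fun _ ↦ ENNReal.ofReal_ne_top)
  have hμν : μ.rnDeriv ν =ᵐ[volume]
      fun x ↦ (ENNReal.ofReal (exp (-v x)))⁻¹ * μ.rnDeriv volume x := by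
    rw [hν.eq_withDensity]
    exact Measure.rnDeriv_withDensity_right _ _ hν.measurable_density.aemeasurable
      (ae_of_all _ fun _ ↦ (ENNReal.ofReal_pos.2 (exp_pos _)).ne')
      (ae_of_all _ fun _ ↦ ENNReal.ofReal_ne_top)
  have hμ_vol : μ.rnDeriv volume =ᵐ[volume] fun x ↦ ENNReal.ofReal (exp (-u x)) := by
    rw [hμ.eq_withDensity]
    exact Measure.rnDeriv_withDensity _ hμ.measurable_density
  filter_upwards [hμ.absolutelyContinuous.ae_le hμν, hμ.absolutelyContinuous.ae_le hμ_vol]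
    with x hxν hx_vol
  rw [llr, hxν, hx_vol, ENNReal.toReal_mul, ENNReal.toReal_inv,
    ENNReal.toReal_ofReal (exp_pos _).le, ENNReal.toReal_ofReal (exp_pos _).le, ← exp_neg,
    ← exp_add, log_exp]
  ring

end HasPotential

lemma hasDerivAt_gaussianPotential (m : ℝ) (s : ℝ≥0) (x : ℝ) :
    HasDerivAt (gaussianPotential m s) ((x - m) / s) x := by
  refine (((((hasDerivAt_id x).sub_const m).pow 2).div_const (2 * (s : ℝ))).add_const
    (log √(2 * π * s))).congr_deriv ?_
  simp only [id, Nat.add_one_sub_one, pow_one, mul_one, Nat.cast_ofNat]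
  exact mul_div_mul_left _ _ two_ne_zero

lemma deriv_gaussianPotential (m : ℝ) (s : ℝ≥0) :
    deriv (gaussianPotential m s) = fun x ↦ (x - m) / s :=
  funext fun x ↦ (hasDerivAt_gaussianPotential m s x).deriv

lemma gaussianPotential_sub (m : ℝ) (s : ℝ≥0) (x y : ℝ) :
    gaussianPotential m s y - gaussianPotential m s x = ((y - m) ^ 2 - (x - m) ^ 2) / (2 * s) := by
  rw [gaussianPotential, gaussianPotential]
  ring

lemma differentiable_gaussianPotential (m : ℝ) (s : ℝ≥0) :
    Differentiable ℝ (gaussianPotential m s) := fun x ↦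
  (hasDerivAt_gaussianPotential m s x).differentiableAt

lemma tendsto_gaussianPotential_cocompact (m : ℝ) {s : ℝ≥0} (hs : s ≠ 0) :
    Tendsto (gaussianPotential m s) (cocompact ℝ) atTop := by
  have hdist : Tendsto (fun x ↦ |x - m|) (cocompact ℝ) atTop :=
    tendsto_dist_right_cocompact_atTop m
  refine tendsto_atTop_add_const_right _ _ (Tendsto.atTop_div_const (by positivity) ?_)
  simpa only [Function.comp_def, sq_abs] using (tendsto_pow_atTop two_ne_zero).comp hdist

lemma hasPotential_gaussianReal (m : ℝ) {s : ℝ≥0} (hs : s ≠ 0) :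
    HasPotential (gaussianReal m s) (gaussianPotential m s) where
  continuous := (differentiable_gaussianPotential m s).continuous
  eq_withDensity := by
    rw [gaussianReal_of_var_ne_zero m hs]
    congr 1 with x
    have hpos : 0 < √(2 * π * s) := by positivity
    rw [gaussianPDF, gaussianPDFReal, gaussianPotential, neg_add_rev, exp_add, exp_neg,
      exp_log hpos, neg_div]

end Potential

section Poincare

lemma memLp_of_lipschitzWith {E F : Type*} [NormedAddCommGroup E] [NormedAddCommGroup F]
    [MeasurableSpace E] {μ : Measure E} [IsFiniteMeasure μ] {p : ℝ≥0∞} {L : ℝ≥0} {f : E → F}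
    (hf : LipschitzWith L f) (hμ : MemLp id p μ) : MemLp f p μ := by
  have hsub : LipschitzWith L fun x ↦ f x - f 0 := by
    simpa using hf.sub (LipschitzWith.const (f 0))
  simpa only [id, Function.comp_def, Pi.add_def, sub_add_cancel] using
    (hsub.comp_memLp (by simp) hμ).add (memLp_const (f 0))

variable {k : ℝ → ℝ} {L : ℝ≥0}

lemma memLp_deriv_of_lipschitzWith (hkL : LipschitzWith L k) {μ : Measure ℝ} [IsFiniteMeasure μ]
    (p : ℝ≥0∞) : MemLp (deriv k) p μ :=
  .of_bound (measurable_deriv k).aestronglyMeasurable L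
    (ae_of_all _ fun _ ↦ norm_deriv_le_of_lipschitz hkL)

lemma continuous_dslope (hk : Differentiable ℝ k) (a : ℝ) : Continuous (dslope k a) := by
  rw [← continuousOn_univ, continuousOn_dslope univ_mem]
  exact ⟨hk.continuous.continuousOn, hk a⟩

lemma norm_dslope_le_of_lipschitzWith (hkL : LipschitzWith L k) (a x : ℝ) :
    ‖dslope k a x‖ ≤ L := by
  rcases eq_or_ne x a with rfl | hx
  · rw [dslope_same]
    exact norm_deriv_le_of_lipschitz hkL
  · rw [dslope_of_ne _ hx, slope_def_module, norm_smul, norm_inv,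
      inv_mul_le_iff₀ (norm_pos_iff.2 (sub_ne_zero.2 hx)), mul_comm]
    exact hkL.norm_sub_le x a

lemma hasDerivAt_sub_mul_dslope_sq (hk : Differentiable ℝ k) (a x : ℝ) :
    HasDerivAt (fun x ↦ (x - a) * dslope k a x ^ 2)
      (deriv k x ^ 2 - (deriv k x - dslope k a x) ^ 2) x := by
  rcases eq_or_ne x a with rfl | hx
  · rw [hasDerivAt_iff_tendsto_slope]
    have hlim : Tendsto (fun y ↦ dslope k x y ^ 2) (𝓝[≠] x) (𝓝 (deriv k x ^ 2)) := by
      simpa only [Pi.pow_apply, dslope_same, Pi.pow_def] using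
        (((continuous_dslope hk x).pow 2).tendsto x).mono_left nhdsWithin_le_nhds
    simp only [dslope_same, sub_self, ne_eq, OfNat.ofNat_ne_zero, not_false_eq_true, zero_pow,
      sub_zero]
    refine hlim.congr' ?_
    filter_upwards [self_mem_nhdsWithin] with y hy
    rw [slope_def_field, sub_self, zero_mul, sub_zero, mul_div_cancel_left₀ _ (sub_ne_zero.2 hy)]
  · have hxa : x - a ≠ 0 := sub_ne_zero.2 hx
    have hquot : HasDerivAt (fun y ↦ (k y - k a) ^ 2 / (y - a))
        (deriv k x ^ 2 - (deriv k x - dslope k a x) ^ 2) x := by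
      refine ((((hk x).hasDerivAt.sub_const (k a)).pow 2).div
        ((hasDerivAt_id x).sub_const a) hxa).congr_deriv ?_
      simp only [Pi.pow_apply, id, dslope_of_ne _ hx, slope_def_field]
      field_simp
      ring
    refine hquot.congr_of_eventuallyEq ?_
    filter_upwards [isOpen_ne.mem_nhds hx] with y hy
    have hya : y - a ≠ 0 := sub_ne_zero.2 hy
    rw [dslope_of_ne _ hy, slope_def_field]
    field_simp

lemma integral_sub_sq_gaussianReal_le (hk : Differentiable ℝ k) (hkL : LipschitzWith L k) (m : ℝ)
    {s : ℝ≥0} (hs : s ≠ 0) :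
    ∫ x, (k x - k m) ^ 2 ∂(gaussianReal m s) ≤ s * ∫ x, deriv k x ^ 2 ∂(gaussianReal m s) := by
  -- Stein's identity for `(x - m) * dslope k m x ^ 2 = (k x - k m) ^ 2 / (x - m)` leaves the gap
  -- `∫ (k' - dslope k m) ^ 2 ≥ 0` between the two sides.
  set γ := gaussianReal m s
  have hk' : MemLp (deriv k) 2 γ := memLp_deriv_of_lipschitzWith hkL 2
  have hw : MemLp (dslope k m) 2 γ :=
    .of_bound (continuous_dslope hk m).aestronglyMeasurable L
      (ae_of_all _ (norm_dslope_le_of_lipschitzWith hkL m))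
  have hkm : MemLp (fun x ↦ k x - k m) 2 γ :=
    (memLp_of_lipschitzWith hkL (memLp_id_gaussianReal 2)).sub (memLp_const _)
  have hsub_mul (x : ℝ) : (x - m) * dslope k m x = k x - k m := sub_smul_dslope k m x
  have hflux : Integrable (fun x ↦ (x - m) * dslope k m x ^ 2) γ := by
    simpa only [Pi.mul_def, ← hsub_mul, mul_assoc, ← sq] using hkm.integrable_mul hw
  have hterm (x : ℝ) : deriv (gaussianPotential m s) x * ((x - m) * dslope k m x ^ 2) =
      (k x - k m) ^ 2 / s := by
    rw [deriv_gaussianPotential, ← hsub_mul]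
    ring
  have hgap : Integrable (fun x ↦ (deriv k x - dslope k m x) ^ 2) γ := (hk'.sub hw).integrable_sq
  have hdiff : Integrable (fun x ↦ deriv k x ^ 2 - (deriv k x - dslope k m x) ^ 2) γ :=
    hk'.integrable_sq.sub hgap
  have hstein := (hasPotential_gaussianReal m hs).integral_deriv_sub_deriv_mul_eq_zero
    (differentiable_gaussianPotential m s) (hasDerivAt_sub_mul_dslope_sq hk m) hflux
  simp only [hterm] at hstein
  specialize hstein (hdiff.sub (hkm.integrable_sq.div_const _))
  rw [integral_sub hdiff (hkm.integrable_sq.div_const _), integral_sub hk'.integrable_sq hgap,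
    integral_div] at hstein
  have hgap_nonneg : 0 ≤ ∫ x, (deriv k x - dslope k m x) ^ 2 ∂γ :=
    integral_nonneg fun _ ↦ sq_nonneg _
  rw [← div_le_iff₀' (by positivity)]
  linarith

lemma variance_gaussianReal_le (hk : Differentiable ℝ k) (hkL : LipschitzWith L k) (m : ℝ)
    (s : ℝ≥0) :
    Var[k; gaussianReal m s] ≤ s * ∫ x, deriv k x ^ 2 ∂(gaussianReal m s) := by
  rcases eq_or_ne s 0 with rfl | hs
  · simp [gaussianReal_zero_var]
  have hmeas := hk.continuous.aestronglyMeasurable (μ := gaussianReal m s)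
  calc Var[k; gaussianReal m s] = Var[fun x ↦ k x - k m; gaussianReal m s] :=
        (variance_sub_const hmeas _).symm
    _ ≤ ∫ x, (k x - k m) ^ 2 ∂(gaussianReal m s) :=
        variance_le_expectation_sq (hmeas.sub aestronglyMeasurable_const)
    _ ≤ s * ∫ x, deriv k x ^ 2 ∂(gaussianReal m s) := integral_sub_sq_gaussianReal_le hk hkL m hs

lemma integral_sub_mul_gaussianReal (hk : Differentiable ℝ k) (hkL : LipschitzWith L k) (m : ℝ)
    (s : ℝ≥0) :
    ∫ x, (x - m) * k x ∂(gaussianReal m s) = s * ∫ x, deriv k x ∂(gaussianReal m s) := by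
  rcases eq_or_ne s 0 with rfl | hs
  · simp [gaussianReal_zero_var]
  have hk2 : MemLp k 2 (gaussianReal m s) := memLp_of_lipschitzWith hkL (memLp_id_gaussianReal 2)
  have hk' := memLp_deriv_of_lipschitzWith hkL (μ := gaussianReal m s) 1
  have hxm : MemLp (fun x ↦ x - m) 2 (gaussianReal m s) :=
    (memLp_id_gaussianReal 2).sub (memLp_const m)
  have hxk : Integrable (fun x ↦ (x - m) * k x) (gaussianReal m s) := hxm.integrable_mul hk2
  have hterm (x : ℝ) : deriv (gaussianPotential m s) x * k x = (x - m) * k x / s := by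
    rw [deriv_gaussianPotential, div_mul_eq_mul_div]
  have hstein := (hasPotential_gaussianReal m hs).integral_deriv_sub_deriv_mul_eq_zero
    (differentiable_gaussianPotential m s) (fun x ↦ (hk x).hasDerivAt) (hk2.integrable one_le_two)
  simp only [hterm] at hstein
  specialize hstein ((hk'.integrable le_rfl).sub (hxk.div_const _))
  rw [integral_sub (hk'.integrable le_rfl) (hxk.div_const _), integral_div, sub_eq_zero] at hstein
  rw [hstein]
  field_simp

end Poincare

section Transport

lemma hasDerivAt_of_comp {f g h : ℝ → ℝ} {f' h' x : ℝ} (hg : ContinuousAt g x)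
    (hf : HasDerivAt f f' (g x)) (hh : HasDerivAt h h' x) (hf' : f' ≠ 0)
    (hcomp : ∀ y, f (g y) = h y) : HasDerivAt g (h' / f') x := by
  have hinv : Function.LeftInverse (.toSpanSingleton ℝ f'⁻¹ : ℝ →L[ℝ] ℝ)
      (.toSpanSingleton ℝ f' : ℝ →L[ℝ] ℝ) := fun y ↦ by simp [hf']
  simpa [div_eq_mul_inv] using (HasFDerivAt.of_comp_of_leftInverse hg hf.hasFDerivAt
    hh.hasFDerivAt (Eventually.of_forall hcomp) hinv).hasDerivAt

variable {μ ν : Measure ℝ} [IsProbabilityMeasure μ] [IsProbabilityMeasure ν] {u v : ℝ → ℝ}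

namespace HasPotential

lemma hasDerivAt_cdf (hμ : HasPotential μ u) (x : ℝ) : HasDerivAt (cdf μ) (exp (-u x)) x := by
  have hcont : Continuous fun t ↦ exp (-u t) := hμ.continuous.neg.rexp
  have hint : Integrable fun t ↦ exp (-u t) := by
    simpa using hμ.integrable_iff.1 (integrable_const (1 : ℝ))
  have hcdf (y : ℝ) : cdf μ y = ∫ t in Iic y, exp (-u t) := by
    have h := ofReal_cdf μ y
    rw [congrArg (· (Iic y)) hμ.eq_withDensity] at h
    rw [withDensity_apply _ measurableSet_Iic,
      ← ofReal_integral_eq_lintegral_ofReal hint.integrableOn (ae_of_all _ fun t ↦ (exp_pos _).le),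
      ENNReal.ofReal_eq_ofReal_iff (cdf_nonneg _ _)
        (integral_nonneg fun t ↦ (exp_pos _).le)] at h
    exact h
  have hcdf_zero : (cdf μ : ℝ → ℝ) = fun y ↦ cdf μ 0 + ∫ t in (0 : ℝ)..y, exp (-u t) :=
    funext fun y ↦ by
      rw [← intervalIntegral.integral_Iic_sub_Iic hint.integrableOn hint.integrableOn, ← hcdf,
        ← hcdf, add_sub_cancel]
  rw [hcdf_zero]
  exact (hcont.integral_hasStrictDerivAt 0 x).hasDerivAt.const_add _

lemma strictMono_cdf (hμ : HasPotential μ u) : StrictMono (cdf μ) :=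
  strictMono_of_deriv_pos fun x ↦ by
    rw [(hμ.hasDerivAt_cdf x).deriv]
    exact exp_pos _

lemma range_cdf (hμ : HasPotential μ u) : range (cdf μ) = Ioo 0 1 := by
  have hcont : Continuous (cdf μ) :=
    continuous_iff_continuousAt.2 fun x ↦ (hμ.hasDerivAt_cdf x).continuousAt
  refine Subset.antisymm (range_subset_iff.2 fun x ↦ ⟨?_, ?_⟩) fun p hp ↦ ?_
  · exact (cdf_nonneg μ (x - 1)).trans_lt (hμ.strictMono_cdf (sub_one_lt x))
  · exact (hμ.strictMono_cdf (lt_add_one x)).trans_le (cdf_le_one μ (x + 1))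
  · exact mem_range_of_exists_le_of_exists_ge hcont
      ((tendsto_cdf_atBot μ).eventually_le_const hp.1).exists
      ((tendsto_cdf_atTop μ).eventually_const_le hp.2).exists

/-- The cumulative distribution function as an order isomorphism onto `(0, 1)`; its inverse is the
quantile function. -/
noncomputable def cdfIso (hμ : HasPotential μ u) : ℝ ≃o Ioo (0 : ℝ) 1 :=
  (hμ.strictMono_cdf.orderIso (cdf μ)).trans (OrderIso.setCongr _ _ hμ.range_cdf)

lemma coe_cdfIso (hμ : HasPotential μ u) (x : ℝ) : (hμ.cdfIso x : ℝ) = cdf μ x := rfl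

/-- The increasing (monotone rearrangement) map that pushes `ν` forward to `μ`. -/
noncomputable def transport (hν : HasPotential ν u) (hμ : HasPotential μ v) : ℝ ≃o ℝ :=
  hν.cdfIso.trans hμ.cdfIso.symm

lemma cdf_transport (hν : HasPotential ν u) (hμ : HasPotential μ v) (x : ℝ) :
    cdf μ (hν.transport hμ x) = cdf ν x := by
  rw [← hμ.coe_cdfIso, transport, OrderIso.trans_apply, OrderIso.apply_symm_apply, hν.coe_cdfIso]

lemma hasDerivAt_transport (hν : HasPotential ν u) (hμ : HasPotential μ v) (x : ℝ) :
    HasDerivAt (hν.transport hμ) (exp (v (hν.transport hμ x) - u x)) x := by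
  refine (hasDerivAt_of_comp (hν.transport hμ).continuous.continuousAt
    (hμ.hasDerivAt_cdf (hν.transport hμ x)) (hν.hasDerivAt_cdf x) (exp_ne_zero _)
    (hν.cdf_transport hμ)).congr_deriv ?_
  rw [← exp_sub]
  ring_nf

lemma deriv_transport_pos (hν : HasPotential ν u) (hμ : HasPotential μ v) (x : ℝ) :
    0 < deriv (hν.transport hμ) x := by
  rw [(hν.hasDerivAt_transport hμ x).deriv]
  exact exp_pos _

lemma measurePreserving_transport (hν : HasPotential ν u) (hμ : HasPotential μ v) :
    MeasurePreserving (hν.transport hμ) ν μ := by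
  set T := hν.transport hμ
  have hmeas : Measurable T := T.continuous.measurable
  have := Measure.isProbabilityMeasure_map (μ := ν) hmeas.aemeasurable
  refine ⟨hmeas, Measure.ext_of_Iic _ _ fun y ↦ ?_⟩
  rw [Measure.map_apply hmeas measurableSet_Iic, ← T.apply_symm_apply y, T.preimage_Iic,
    T.symm_apply_apply, ← ofReal_cdf, ← ofReal_cdf, cdf_transport]

lemma llr_transport_ae_eq (hν : HasPotential ν u) (hμ : HasPotential μ v) :
    (fun x ↦ llr μ ν (hν.transport hμ x)) =ᵐ[ν]
      fun x ↦ u (hν.transport hμ x) - u x - log (deriv (hν.transport hμ) x) := by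
  filter_upwards [(hν.measurePreserving_transport hμ).quasiMeasurePreserving.ae
    (hμ.llr_ae_eq hν)] with x hx
  rw [hx, (hν.hasDerivAt_transport hμ x).deriv, log_exp]
  ring

lemma integrable_transport_of_klDiv_ne_top (hν : HasPotential ν u) (hμ : HasPotential μ v)
    (hfin : klDiv μ ν ≠ ∞) :
    Integrable (fun x ↦ u (hν.transport hμ x) - u x - log (deriv (hν.transport hμ) x)) ν :=
  (integrable_congr (hν.llr_transport_ae_eq hμ)).1
    ((hν.measurePreserving_transport hμ).integrable_comp_of_integrable
      (klDiv_ne_top_iff.1 hfin).2)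

lemma klDiv_eq_ofReal_integral_transport (hν : HasPotential ν u) (hμ : HasPotential μ v)
    (hfin : klDiv μ ν ≠ ∞) :
    klDiv μ ν = ENNReal.ofReal
      (∫ x, (u (hν.transport hμ x) - u x - log (deriv (hν.transport hμ) x)) ∂ν) := by
  obtain ⟨hac, hllr⟩ := klDiv_ne_top_iff.1 hfin
  rw [klDiv_of_ac_of_integrable hac hllr, probReal_univ, probReal_univ, add_sub_cancel_right,
    ← integral_congr_ae (hν.llr_transport_ae_eq hμ),
    (hν.measurePreserving_transport hμ).integral_comp
      (hν.transport hμ).toHomeomorph.measurableEmbedding]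

end HasPotential

end Transport

section Wasserstein

lemma W2_sq_le_lintegral {E : Type*} [MeasurableSpace E] [PseudoEMetricSpace E]
    [OpensMeasurableSpace E] [SecondCountableTopology E] {μ ν : Measure E} {T : E → E}
    (hT : MeasurePreserving T ν μ) : W2 μ ν ^ 2 ≤ ∫⁻ x, edist (T x) x ^ 2 ∂ν := by
  have hgraph : Measurable fun x ↦ (T x, x) := hT.measurable.prodMk measurable_id
  have hcoupling : IsCoupling (ν.map fun x ↦ (T x, x)) μ ν :=
    ⟨by rw [Measure.map_map measurable_fst hgraph]; exact hT.map_eq,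
      by rw [Measure.map_map measurable_snd hgraph]; exact Measure.map_id⟩
  have hW : W2 μ ν ≤ (∫⁻ x, edist (T x) x ^ 2 ∂ν) ^ (1 / 2 : ℝ) := by
    refine (iInf₂_le (ν.map fun x ↦ (T x, x)) hcoupling).trans_eq ?_
    rw [lintegral_map (by fun_prop) hgraph]
  calc W2 μ ν ^ 2 ≤ ((∫⁻ x, edist (T x) x ^ 2 ∂ν) ^ (1 / 2 : ℝ)) ^ 2 := by gcongr
    _ = ∫⁻ x, edist (T x) x ^ 2 ∂ν := by
      rw [← ENNReal.rpow_natCast, ← ENNReal.rpow_mul]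
      norm_num

lemma W2_sq_le_ofReal_integral {E : Type*} [MeasurableSpace E] [PseudoMetricSpace E]
    [OpensMeasurableSpace E] [SecondCountableTopology E] {μ ν : Measure E} {T : E → E}
    (hT : MeasurePreserving T ν μ) (hint : Integrable (fun x ↦ dist (T x) x ^ 2) ν) :
    W2 μ ν ^ 2 ≤ ENNReal.ofReal (∫ x, dist (T x) x ^ 2 ∂ν) := by
  rw [ofReal_integral_eq_lintegral_ofReal hint (ae_of_all _ fun _ ↦ sq_nonneg _)]
  simpa only [edist_dist, ENNReal.ofReal_pow dist_nonneg] using W2_sq_le_lintegral hT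

lemma W2_sq_gaussianReal_le {μ : Measure ℝ} {m : ℝ} {s : ℝ≥0} {T : ℝ → ℝ} {L : ℝ≥0}
    (hT : MeasurePreserving T (gaussianReal m s) μ) (hTL : LipschitzWith L T) :
    W2 μ (gaussianReal m s) ^ 2 ≤ ENNReal.ofReal (∫ x, (T x - x) ^ 2 ∂(gaussianReal m s)) := by
  have hint := (memLp_of_lipschitzWith (hTL.sub .id)
    (memLp_id_gaussianReal (μ := m) (v := s) 2)).integrable_sq
  simpa only [Real.dist_eq, sq_abs] using
    W2_sq_le_ofReal_integral hT (by simpa only [Real.dist_eq, sq_abs, id] using hint)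

end Wasserstein

section Deficit

variable {T : ℝ → ℝ} {r : ℝ}

lemma lipschitzWith_of_mul_deriv_le_one (hT : Differentiable ℝ T) (hT' : ∀ x, 0 < deriv T x)
    (hr : 0 < r) (hTr : ∀ x, r * deriv T x ≤ 1) : LipschitzWith r⁻¹.toNNReal T := by
  refine lipschitzWith_of_nnnorm_deriv_le hT fun x ↦ ?_
  rw [← NNReal.coe_le_coe, coe_nnnorm, Real.norm_of_nonneg (hT' x).le,
    Real.coe_toNNReal _ (inv_nonneg.2 hr.le), ← one_div, le_div_iff₀' hr]
  exact hTr x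

lemma half_sq_add_mul_sq_le {x y y' : ℝ} (hr0 : 0 ≤ r) (hr1 : r ≤ 1) (hy' : 0 < y')
    (hry' : r * y' ≤ 1) :
    (y - x) ^ 2 / 2 + (x * (y - x) - (y' - 1)) + (1 - log 2) * r * (y' - 1) ^ 2 ≤
      (y ^ 2 - x ^ 2) / 2 - log y' := by
  have hlog := one_sub_log_two_mul_sq_le hr1 (u := y' - 1) (by linarith) (by linarith)
  rw [add_sub_cancel] at hlog
  linarith

lemma half_integral_sq_add_mul_variance_le {k g : ℝ → ℝ} {L : ℝ≥0} {c : ℝ}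
    (hk : Differentiable ℝ k) (hkL : LipschitzWith L k) (hc : 0 ≤ c)
    (hg : Integrable g (gaussianReal 0 1))
    (hle : ∀ x, k x ^ 2 / 2 + (x * k x - deriv k x) + c * deriv k x ^ 2 ≤ g x) :
    (∫ x, k x ^ 2 ∂(gaussianReal 0 1)) / 2 + c * Var[k; gaussianReal 0 1] ≤
      ∫ x, g x ∂(gaussianReal 0 1) := by
  set γ := gaussianReal 0 1
  have hk2 : MemLp k 2 γ := memLp_of_lipschitzWith hkL (memLp_id_gaussianReal 2)
  have hk' : MemLp (deriv k) 2 γ := memLp_deriv_of_lipschitzWith hkL 2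
  have hk'_int : Integrable (deriv k) γ := hk'.integrable one_le_two
  have hxk : Integrable (fun x ↦ x * k x) γ :=
    (memLp_id_gaussianReal' 2 (by simp)).integrable_mul hk2
  have hcross : Integrable (fun x ↦ x * k x - deriv k x) γ := hxk.sub hk'_int
  have hsum : Integrable (fun x ↦ k x ^ 2 / 2 + (x * k x - deriv k x)) γ :=
    (hk2.integrable_sq.div_const 2).add hcross
  have hstein : ∫ x, x * k x ∂γ = ∫ x, deriv k x ∂γ := by
    simpa using integral_sub_mul_gaussianReal hk hkL 0 1
  have hpoincare : Var[k; γ] ≤ ∫ x, deriv k x ^ 2 ∂γ := by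
    simpa using variance_gaussianReal_le hk hkL 0 1
  calc (∫ x, k x ^ 2 ∂γ) / 2 + c * Var[k; γ]
      ≤ (∫ x, k x ^ 2 ∂γ) / 2 + c * ∫ x, deriv k x ^ 2 ∂γ := by gcongr
    _ = ∫ x, (k x ^ 2 / 2 + (x * k x - deriv k x) + c * deriv k x ^ 2) ∂γ := by
      rw [integral_add hsum (hk'.integrable_sq.const_mul c),
        integral_add (hk2.integrable_sq.div_const 2) hcross, integral_sub hxk hk'_int,
        hstein, sub_self, add_zero, integral_div, integral_const_mul]
    _ ≤ ∫ x, g x ∂γ := integral_mono (hsum.add (hk'.integrable_sq.const_mul c)) hg hle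

lemma add_mul_integral_sq_le (hT : Differentiable ℝ T) (hT' : ∀ x, 0 < deriv T x) (hr0 : 0 < r)
    (hr1 : r ≤ 1) (hTr : ∀ x, r * deriv T x ≤ 1)
    (hint : Integrable (fun x ↦ (T x ^ 2 - x ^ 2) / 2 - log (deriv T x)) (gaussianReal 0 1)) :
    (1 / 2 + (1 - log 2) * r) * ∫ x, (T x - x) ^ 2 ∂(gaussianReal 0 1) ≤
      ∫ x, ((T x ^ 2 - x ^ 2) / 2 - log (deriv T x)) ∂(gaussianReal 0 1) +
        (1 - log 2) * r * (∫ x, T x ∂(gaussianReal 0 1)) ^ 2 := by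
  have hTL := lipschitzWith_of_mul_deriv_le_one hT hT' hr0 hTr
  have hid : MemLp (fun x : ℝ ↦ x) 2 (gaussianReal 0 1) := memLp_id_gaussianReal 2
  have hT2 : MemLp T 2 (gaussianReal 0 1) := memLp_of_lipschitzWith hTL hid
  have hc : 0 ≤ (1 - log 2) * r := mul_nonneg one_sub_log_two_pos.le hr0.le
  have hderiv (x : ℝ) : deriv (fun x ↦ T x - x) x = deriv T x - 1 :=
    ((hT x).hasDerivAt.sub (hasDerivAt_id x)).deriv
  have hmean : ∫ x, (T x - x) ∂(gaussianReal 0 1) = ∫ x, T x ∂(gaussianReal 0 1) := by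
    rw [integral_sub (hT2.integrable one_le_two) (hid.integrable one_le_two),
      integral_id_gaussianReal, sub_zero]
  have hvar : Var[fun x ↦ T x - x; gaussianReal 0 1] =
      ∫ x, (T x - x) ^ 2 ∂(gaussianReal 0 1) - (∫ x, T x ∂(gaussianReal 0 1)) ^ 2 := by
    rw [← hmean]
    exact variance_eq_sub (hT2.sub hid)
  have hdeficit := half_integral_sq_add_mul_variance_le (k := fun x ↦ T x - x)
    (hT.sub differentiable_id) (hTL.sub .id) hc hint fun x ↦ by
      rw [hderiv]
      exact half_sq_add_mul_sq_le hr0.le hr1 (hT' x) (hTr x)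
  rw [hvar] at hdeficit
  linarith

end Deficit

namespace HasPotential

variable {μ : Measure ℝ} [IsProbabilityMeasure μ] {v : ℝ → ℝ}

lemma gaussian_transport_mul_deriv_le_one {ε : ℝ} (hμ : HasPotential μ v) (hv : Differentiable ℝ v)
    (hvε : ∀ x, ε ≤ deriv (deriv v) x) (hε : 0 < ε) (x : ℝ) :
    √ε * deriv ((hasPotential_gaussianReal 0 one_ne_zero).transport hμ) x ≤ 1 := by
  set hγ := hasPotential_gaussianReal 0 one_ne_zero
  have hγ'' (y : ℝ) : HasDerivAt (deriv (gaussianPotential 0 1)) 1 y := by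
    simpa [deriv_gaussianPotential] using hasDerivAt_id' y
  rw [(hγ.hasDerivAt_transport hμ x).deriv, ← sqrt_one]
  exact sqrt_mul_exp_sub_le_sqrt (differentiable_gaussianPotential 0 1)
    (fun y ↦ (hγ'' y).differentiableAt) (fun y ↦ (hγ'' y).deriv.le) one_pos
    (tendsto_gaussianPotential_cocompact 0 one_ne_zero) hv hvε hε (hγ.hasDerivAt_transport hμ) x

lemma ofReal_mul_W2_sq_gaussian_le {r : ℝ} (hμ : HasPotential μ v) (hr0 : 0 < r) (hr1 : r ≤ 1)
    (hr : ∀ x, r * deriv ((hasPotential_gaussianReal 0 one_ne_zero).transport hμ) x ≤ 1) :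
    ENNReal.ofReal (1 / 2 + (1 - log 2) * r) * W2 μ (gaussianReal 0 1) ^ 2 ≤
      klDiv μ (gaussianReal 0 1) + ENNReal.ofReal ((1 - log 2) * r * (∫ x, x ∂μ) ^ 2) := by
  rcases eq_or_ne (klDiv μ (gaussianReal 0 1)) ∞ with htop | hfin
  · simp [htop]
  set hγ := hasPotential_gaussianReal 0 one_ne_zero
  set γ := gaussianReal 0 1
  let T := hγ.transport hμ
  have hT : MeasurePreserving T γ μ := hγ.measurePreserving_transport hμ
  have hT_diff : Differentiable ℝ T := fun x ↦ (hγ.hasDerivAt_transport hμ x).differentiableAt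
  have hT' : ∀ x, 0 < deriv T x := hγ.deriv_transport_pos hμ
  have hc : 0 ≤ (1 - log 2) * r := mul_nonneg one_sub_log_two_pos.le hr0.le
  have hint := hγ.integrable_transport_of_klDiv_ne_top hμ hfin
  have hkl := hγ.klDiv_eq_ofReal_integral_transport hμ hfin
  simp only [gaussianPotential_sub, sub_zero, NNReal.coe_one, mul_one] at hint hkl
  have hmean : ∫ x, T x ∂γ = ∫ x, x ∂μ :=
    hT.integral_comp T.toHomeomorph.measurableEmbedding fun x ↦ x
  calc ENNReal.ofReal (1 / 2 + (1 - log 2) * r) * W2 μ γ ^ 2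
      ≤ ENNReal.ofReal (1 / 2 + (1 - log 2) * r) * ENNReal.ofReal (∫ x, (T x - x) ^ 2 ∂γ) := by
        gcongr
        exact W2_sq_gaussianReal_le hT (lipschitzWith_of_mul_deriv_le_one hT_diff hT' hr0 hr)
    _ = ENNReal.ofReal ((1 / 2 + (1 - log 2) * r) * ∫ x, (T x - x) ^ 2 ∂γ) :=
        (ENNReal.ofReal_mul (by linarith)).symm
    _ ≤ ENNReal.ofReal (∫ x, ((T x ^ 2 - x ^ 2) / 2 - log (deriv T x)) ∂γ +
          (1 - log 2) * r * (∫ x, T x ∂γ) ^ 2) :=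
        ENNReal.ofReal_le_ofReal (add_mul_integral_sq_le hT_diff hT' hr0 hr1 hr hint)
    _ ≤ klDiv μ γ + ENNReal.ofReal ((1 - log 2) * r * (∫ x, x ∂μ) ^ 2) := by
        rw [hkl, ← hmean]
        exact ENNReal.ofReal_add_le

end HasPotential

theorem theorem4p2_general (μ : Measure ℝ) [IsProbabilityMeasure μ]
    (v : ℝ → ℝ) (hv : Differentiable ℝ v)
    (hμ : μ = volume.withDensity (fun x => ENNReal.ofReal (Real.exp (-v x))))
    (ε : ℝ) (hε : 0 < ε) (hconv : ∀ x : ℝ, ε ≤ deriv (deriv v) x) :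
    ENNReal.ofReal (1 / 2 + (1 - Real.log 2) * min 1 (Real.sqrt ε)) *
        W2 μ (gaussianReal 0 1) ^ 2 ≤
      klDiv μ (gaussianReal 0 1) +
        ENNReal.ofReal ((1 - Real.log 2) * min 1 (Real.sqrt ε) * (∫ x, x ∂μ) ^ 2) := by
  have hpot : HasPotential μ v := ⟨hv.continuous, hμ⟩
  refine hpot.ofReal_mul_W2_sq_gaussian_le (lt_min one_pos (sqrt_pos.2 hε)) (min_le_left _ _)
    fun x ↦ ?_
  have hT' := (hasPotential_gaussianReal 0 one_ne_zero).deriv_transport_pos hpot x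
  exact (mul_le_mul_of_nonneg_right (min_le_right _ _) hT'.le).trans
    (hpot.gaussian_transport_mul_deriv_le_one hv hconv hε x)

theorem theorem4p2 (μ : Measure ℝ) [IsProbabilityMeasure μ]
    (v : ℝ → ℝ) (hv : ContDiff ℝ 2 v)
    (hμ : μ = volume.withDensity (fun x => ENNReal.ofReal (Real.exp (-v x))))
    (ε : ℝ) (hε : 0 < ε) (hconv : ∀ x : ℝ, ε ≤ deriv (deriv v) x)
    (hmean : ∫ x, x ∂μ = 0) :
    ENNReal.ofReal (1 / 2 + (1 - Real.log 2) * min 1 (Real.sqrt ε)) *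
        W2 μ (gaussianReal 0 1) ^ 2 ≤
      klDiv μ (gaussianReal 0 1) := by
  simpa [hmean] using theorem4p2_general μ v (hv.differentiable two_ne_zero) hμ ε hε hconv
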